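/- For a finite simple graph $G$ let $\tau(G)$ denote the number of spanning trees of $G$, and let $G_1 \square G_2$ denote the Cartesian product of the simple graphs $G_1$ and $G_2$: the graph with vertex set $V(G_1)\times V(G_2)$ in which $(u,u')$ and $(v,v')$ are adjacent if and only if either $u=v$ and $u'$ is adjacent to $v'$ in $G_2$, or $u'=v'$ and $u$ is adjacent to $v$ in $G_1$. Let $G_1$ and $G_2$ be trees of orders $n_1 \ge 3$ and $n_2 \ge 3$, respectively. Then $$2^{(n_1-1)(n_2-1)}\, n_1^{\frac{n_2-1}{2}}\, n_2^{\frac{n_1-1}{2}} < \tau(G_1 \square G_2) < 2^{2(n_1-1)(n_2-1)}.$$ -/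

import Mathlib

/-- The number `τ(G)` of spanning trees of a simple graph `G`. A spanning subgraph of `G` is a graph
on the same vertex set all of whose edges are edges of `G`, that is, some `T ≤ G`. (The set is
finite when the vertex set is finite.) -/
noncomputable def SimpleGraph.numSpanningTrees {V : Type*} (G : SimpleGraph V) : ℕ :=
  {T : SimpleGraph V | T ≤ G ∧ T.IsTree}.ncard

/-! Let λ_i and μ_j be the nonzero Laplacian eigenvalues of the two trees. By the matrix-tree
theorem the nonzero eigenvalues of a connected graph multiply to its order times its number of
spanning trees, so ∏ λ_i = n₁ and ∏ μ_j = n₂; traces give ∑ λ_i = 2(n₁ - 1) and ∑ μ_j = 2(n₂ - 1).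
The Laplacian of the product is a Kronecker sum, with eigenvalues the sums of those of the factors,
whence τ = ∏ (λ_i + μ_j) (`numSpanningTrees_boxProd_eq_prod`). The lower bound multiplies (λ + μ)² ≥
4λμ over all pairs; the upper bound is AM-GM, the mean of λ_i + μ_j being 4. Both are strict because
the λ_i are not all equal (`exists_ne_of_prod_eq_succ_card`). -/

open Matrix


/-! ### Spanning trees as parent functions -/

/-- The graph whose edges join each vertex to its image under `f`. -/
def functionGraph {V : Type*} (f : V → V) : SimpleGraph V :=
  SimpleGraph.fromRel fun v u => f v = u

/-- `f` fixes `r` and iterating it carries every vertex to `r`. -/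
def IsRootedAt {V : Type*} (r : V) (f : V → V) : Prop :=
  f r = r ∧ ∀ v, ∃ k, f^[k] v = r

lemma IsRootedAt.connected {V : Type*} {r : V} {f : V → V} (h : IsRootedAt r f) :
    (functionGraph f).Connected := by
  have key : ∀ k v, f^[k] v = r → (functionGraph f).Reachable v r := by
    intro k
    induction k with
    | zero => intro v hv; simp at hv; subst hv; rfl
    | succ k ih =>
      intro v hv
      have h1 := ih (f v) hv
      by_cases hvf : v = f v
      · rwa [← hvf] at h1
      · refine SimpleGraph.Reachable.trans (SimpleGraph.Adj.reachable ?_) h1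
        simp [functionGraph, hvf]
  have h2 : ∀ v, (functionGraph f).Reachable v r := fun v => (h.2 v).elim fun k hk => key k v hk
  have : Nonempty V := ⟨r⟩
  exact ⟨fun u v => (h2 u).trans (h2 v).symm⟩

lemma IsRootedAt.isTree {V : Type*} [Fintype V] {r : V} {f : V → V} (h : IsRootedAt r f) :
    (functionGraph f).IsTree := by
  classical
  rw [SimpleGraph.isTree_iff_connected_and_card]
  refine ⟨h.connected, le_antisymm ?_ h.connected.card_vert_le_card_edgeSet_add_one⟩
  have hsub : (functionGraph f).edgeSet ⊆
      ((Finset.univ.erase r).image fun v => s(v, f v) : Finset (Sym2 V)) := by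
    intro e
    induction e with
    | _ a b =>
      simp only [SimpleGraph.mem_edgeSet, functionGraph, SimpleGraph.fromRel_adj, Finset.coe_image,
        Set.mem_image, Finset.mem_coe, Finset.mem_erase, Finset.mem_univ, and_true]
      rintro ⟨hab, rfl | rfl⟩
      · exact ⟨a, fun hr => hab (by rw [hr, h.1]), rfl⟩
      · exact ⟨b, fun hr => hab (by rw [hr, h.1]), Sym2.eq_swap⟩
  have h1 := Set.ncard_le_ncard hsub (Finset.finite_toSet _)
  rw [Set.ncard_coe_finset, ← Nat.card_coe_set_eq] at h1
  have h2 := h1.trans Finset.card_image_le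
  rw [Finset.card_erase_of_mem (Finset.mem_univ r), Finset.card_univ] at h2
  have h3 : 0 < Fintype.card V := Fintype.card_pos_iff.mpr ⟨r⟩
  rw [Nat.card_eq_fintype_card (α := V)]
  omega

lemma IsRootedAt.iterate_ne {V : Type*} {r : V} {f : V → V} (h : IsRootedAt r f)
    (P : V → Prop) (hP : ∀ v, P v → P (f v)) (hr : ¬ P r) (v : V) : ¬ P v := by
  intro hv
  obtain ⟨k, hk⟩ := h.2 v
  have : ∀ k, P (f^[k] v) := fun k => by
    induction k with
    | zero => exact hv
    | succ k ih => rw [Function.iterate_succ_apply']; exact hP _ ih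
  exact hr (hk ▸ this k)

lemma IsRootedAt.apply_ne {V : Type*} {r : V} {f : V → V} (h : IsRootedAt r f) {v : V}
    (hv : v ≠ r) : f v ≠ v := fun hf =>
  h.iterate_ne (fun u => u = v) (fun u hu => by rw [hu, hf]) hv.symm v rfl

/-- Disagreement of `f` and `g` propagates along `g` up to the root, where they agree. Otherwise
some `v` has `f (g v) = v = g (g v)`, a 2-cycle of `g` that misses `r`. -/
lemma IsRootedAt.eq_of_functionGraph_eq {V : Type*} {r : V} {f g : V → V} (hf : IsRootedAt r f)
    (hg : IsRootedAt r g) (hfg : functionGraph f = functionGraph g) : f = g := by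
  have hadj : ∀ v, v ≠ r → f v = g v ∨ f (g v) = v := by
    intro v hv
    have : (functionGraph f).Adj v (g v) := by
      rw [hfg]; simp [functionGraph, (hg.apply_ne hv).symm]
    simpa [functionGraph, (hg.apply_ne hv).symm] using this
  by_contra hne
  obtain ⟨v, hv⟩ := Function.ne_iff.mp hne
  refine hg.iterate_ne (fun v => f v ≠ g v) ?_ (by simp [hf.1, hg.1]) v hv
  intro v hv hw
  have hvr : v ≠ r := by rintro rfl; exact hv (by rw [hf.1, hg.1])
  have h1 := (hadj v hvr).resolve_left hv
  refine hg.iterate_ne (fun u => u = v ∨ u = g v) ?_ ?_ v (Or.inl rfl)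
  · rintro u (rfl | rfl)
    · exact Or.inr rfl
    · exact Or.inl (by rw [← hw, h1])
  · rintro (h | h)
    · exact hvr h.symm
    · rw [← h, hf.1] at h1; exact hvr h1.symm

lemma SimpleGraph.Connected.exists_adj_dist_lt {V : Type*} {G : SimpleGraph V} (h : G.Connected)
    {r v : V} (hv : v ≠ r) : ∃ u, G.Adj v u ∧ G.dist u r < G.dist v r := by
  obtain ⟨p, hp⟩ := h.exists_walk_length_eq_dist v r
  cases p with
  | nil => exact absurd rfl hv
  | cons hadj q =>
    refine ⟨_, hadj, ?_⟩
    have := SimpleGraph.dist_le q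
    simp only [SimpleGraph.Walk.length_cons] at hp
    omega

lemma SimpleGraph.IsTree.exists_isRootedAt {V : Type*} {T : SimpleGraph V} (h : T.IsTree)
    (r : V) : ∃ f, IsRootedAt r f ∧ functionGraph f = T := by
  classical
  -- The parent of a vertex is a neighbour strictly closer to the root.
  choose! f hf using fun v (hv : v ≠ r) => h.connected.exists_adj_dist_lt hv
  let g : V → V := fun v => if v = r then r else f v
  have hg : IsRootedAt r g := by
    refine ⟨by simp [g], ?_⟩
    have : ∀ n v, T.dist v r = n → ∃ k, g^[k] v = r := by
      intro n
      induction n using Nat.strong_induction_on with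
      | _ n ih =>
        intro v hv
        by_cases hvr : v = r
        · exact ⟨0, hvr⟩
        · obtain ⟨k, hk⟩ := ih _ (hv ▸ (hf v hvr).2) (f v) rfl
          exact ⟨k + 1, by simpa [g, hvr] using hk⟩
    exact fun v => this _ v rfl
  refine ⟨g, hg, ?_⟩
  have hle : functionGraph g ≤ T := by
    have haux : ∀ v, v ≠ g v → T.Adj v (g v) := by
      intro v hv
      have hvr : v ≠ r := by rintro rfl; exact hv hg.1.symm
      simpa [g, hvr] using (hf v hvr).1
    intro a b
    simp only [functionGraph, SimpleGraph.fromRel_adj]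
    rintro ⟨hab, rfl | rfl⟩
    · exact haux _ hab
    · exact (haux _ hab.symm).symm
  exact le_antisymm hle
    ((SimpleGraph.isTree_iff_minimal_connected.mp h).2 hg.connected hle)

/-- Spanning trees of `G` correspond to choices of a parent in `G` for each non-root vertex. -/
lemma SimpleGraph.numSpanningTrees_eq_ncard {V : Type*} [Fintype V] (G : SimpleGraph V) (r : V) :
    G.numSpanningTrees =
      {f : V → V | IsRootedAt r f ∧ ∀ v, v ≠ r → G.Adj v (f v)}.ncard := by
  have himg : {T : SimpleGraph V | T ≤ G ∧ T.IsTree} = functionGraph ''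
      {f : V → V | IsRootedAt r f ∧ ∀ v, v ≠ r → G.Adj v (f v)} := by
    ext T
    constructor
    · rintro ⟨hle, hT⟩
      obtain ⟨f, hf, rfl⟩ := hT.exists_isRootedAt r
      refine ⟨f, ⟨hf, fun v hv => hle ?_⟩, rfl⟩
      simp [functionGraph, (hf.apply_ne hv).symm]
    · rintro ⟨f, ⟨hf, hG⟩, rfl⟩
      refine ⟨?_, hf.isTree⟩
      intro a b
      simp only [functionGraph, SimpleGraph.fromRel_adj]
      rintro ⟨hab, rfl | rfl⟩
      · exact hG a (by rintro rfl; exact hab hf.1.symm)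
      · exact (hG b (by rintro rfl; exact hab hf.1)).symm
  rw [numSpanningTrees, himg, Set.InjOn.ncard_image]
  exact fun f hf g hg hfg => hf.1.eq_of_functionGraph_eq hg.1 hfg

/-! ### The matrix-tree theorem -/

/-- The unit vector of the root in row `r`, and `e_v - e_{f v}` in every other row `v`. -/
def parentRow {V : Type*} [DecidableEq V] (r v u : V) : V → ℝ :=
  if v = r then Pi.single r 1 else Pi.single v 1 - Pi.single u 1

/-- The matrix is 1 - N with N nilpotent, so its determinant is the characteristic polynomial X^n of
N evaluated at 1. -/
lemma det_parentRow_of_isRootedAt {V : Type*} [Fintype V] [DecidableEq V] {r : V} {f : V → V}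
    (h : IsRootedAt r f) : (Matrix.of fun v => parentRow r v (f v)).det = 1 := by
  set N : Matrix V V ℝ := Matrix.of fun v u => if v ≠ r ∧ f v = u then 1 else 0 with hN
  have hmul : ∀ (M : Matrix V V ℝ) v u, (N * M) v u = if v = r then 0 else M (f v) u := by
    intro M v u
    by_cases hv : v = r <;> simp [hN, Matrix.mul_apply, hv]
  have hpow : ∀ k v, f^[k] v = r → ∀ u, (N ^ (k + 1)) v u = 0 := by
    intro k
    induction k with
    | zero =>
      intro v hv u
      have := hmul 1 v u
      simp only [Function.iterate_zero, id_eq] at hv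
      simpa [hv] using this
    | succ k ih =>
      intro v hv u
      rw [pow_succ', hmul]
      split_ifs
      · rfl
      · exact ih (f v) hv u
  choose k hk using h.2
  have hstable : ∀ j v, f^[k v + j] v = r := by
    intro j v
    rw [add_comm, Function.iterate_add_apply, hk]
    exact Function.iterate_fixed h.1 j
  have hnil : IsNilpotent N := by
    refine ⟨Finset.univ.sup k + 1, ?_⟩
    ext v u
    obtain ⟨j, hj⟩ := Nat.exists_eq_add_of_le (Finset.le_sup (f := k) (Finset.mem_univ v))
    exact hpow _ v (hj ▸ hstable j v) u
  have hchar := (Matrix.isNilpotent_charpoly_sub_pow_of_isNilpotent hnil).eq_zero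
  have hdet : (Matrix.of fun v => parentRow r v (f v)) = Matrix.scalar V (1 : ℝ) - N := by
    ext v u
    by_cases hv : v = r
    · subst hv; simp [parentRow, hN, Matrix.one_apply, Pi.single_apply, eq_comm]
    · simp only [Matrix.of_apply, parentRow, if_neg hv, Pi.sub_apply, Pi.single_apply, hN,
        Matrix.sub_apply, Matrix.scalar_apply, Matrix.diagonal_apply, eq_comm (a := u)]
      simp [hv]
  rw [hdet, ← Matrix.eval_charpoly, sub_eq_zero.mp hchar]
  simp

/-- The indicator of the vertices whose orbit never reaches `r` lies in the kernel. -/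
lemma det_parentRow_of_not_isRootedAt {V : Type*} [Fintype V] [DecidableEq V] {r : V} {f : V → V}
    (hr : f r = r) (h : ¬ IsRootedAt r f) :
    (Matrix.of fun v => parentRow r v (f v)).det = 0 := by
  classical
  obtain ⟨v₀, hv₀⟩ : ∃ v, ∀ k, f^[k] v ≠ r := by
    by_contra hc
    push Not at hc
    exact h ⟨hr, hc⟩
  have hiff : ∀ v, (∀ k, f^[k] v ≠ r) ↔ (v ≠ r ∧ ∀ k, f^[k] (f v) ≠ r) := by
    intro v
    constructor
    · exact fun hv => ⟨hv 0, fun k => hv (k + 1)⟩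
    · rintro ⟨h0, hv⟩ (_ | k)
      · exact h0
      · exact hv k
  refine Matrix.exists_mulVec_eq_zero_iff.mp
    ⟨fun v => if ∀ k, f^[k] v ≠ r then 1 else 0, fun hx => ?_, ?_⟩
  · simpa [hv₀] using congrFun hx v₀
  · ext v
    by_cases hv : v = r
    · subst hv
      have : ¬ ∀ k, f^[k] v ≠ v := fun hc => hc 0 rfl
      simp only [Matrix.mulVec, Matrix.of_apply, parentRow, if_true, single_dotProduct]
      rw [if_neg this]; simp
    · simp only [Matrix.mulVec, Matrix.of_apply, parentRow, if_neg hv, sub_dotProduct,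
        single_dotProduct, hiff v, Pi.zero_apply]
      simp [hv]

lemma SimpleGraph.lapMatrix_row_eq_sum {V : Type*} [Fintype V] [DecidableEq V] (G : SimpleGraph V)
    [DecidableRel G.Adj] (v : V) :
    G.lapMatrix ℝ v = ∑ u ∈ G.neighborFinset v, (Pi.single v 1 - Pi.single u 1) := by
  ext w
  simp only [lapMatrix, degMatrix, Matrix.sub_apply, Matrix.diagonal_apply, adjMatrix_apply,
    Finset.sum_apply, Pi.sub_apply, Finset.sum_sub_distrib, Finset.sum_const,
    card_neighborFinset_eq_degree, Pi.single_apply, nsmul_eq_mul, Finset.sum_ite_eq,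
    mem_neighborFinset, eq_comm (a := v) (b := w)]
  split_ifs <;> simp

/-- The **matrix-tree theorem**. -/
theorem SimpleGraph.det_lapMatrix_updateRow_single {V : Type*} [Fintype V] [DecidableEq V]
    (G : SimpleGraph V) [DecidableRel G.Adj] (r : V) :
    ((G.lapMatrix ℝ).updateRow r (Pi.single r 1)).det = G.numSpanningTrees := by
  classical
  let A : V → Finset V := fun v => if v = r then {r} else G.neighborFinset v
  have hrows : (G.lapMatrix ℝ).updateRow r (Pi.single r 1) =
      fun v => ∑ u ∈ A v, parentRow r v u := by
    ext1 v
    by_cases hv : v = r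
    · subst hv; simp [A, parentRow]
    · rw [Matrix.updateRow_ne hv, lapMatrix_row_eq_sum]
      simp [A, parentRow, hv]
  -- Multilinearity in the rows: each term of the expansion picks one neighbour as parent of every
  -- non-root vertex.
  have hexp := (Matrix.detRowAlternating (n := V) (R := ℝ)).toMultilinearMap.map_sum_finset
    (fun v u => parentRow r v u) A
  have hdet : ((G.lapMatrix ℝ).updateRow r (Pi.single r 1)).det =
      ∑ f ∈ Fintype.piFinset A, (Matrix.of fun v => parentRow r v (f v)).det := by
    rw [hrows]; exact hexp
  have hA : ∀ f ∈ Fintype.piFinset A, f r = r := fun f hf => by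
    simpa [A] using Fintype.mem_piFinset.mp hf r
  have hterm : ∀ f ∈ Fintype.piFinset A, (Matrix.of fun v => parentRow r v (f v)).det =
      if IsRootedAt r f then 1 else 0 := by
    intro f hf
    split_ifs with h
    · exact det_parentRow_of_isRootedAt h
    · exact det_parentRow_of_not_isRootedAt (hA f hf) h
  rw [hdet, Finset.sum_congr rfl hterm, Finset.sum_boole, G.numSpanningTrees_eq_ncard r,
    ← Set.ncard_coe_finset]
  congr 2
  ext f
  simp only [Finset.coe_filter, Set.mem_ofPred_eq, Fintype.mem_piFinset, and_comm (b := IsRootedAt r f)]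
  refine and_congr_right fun h => forall_congr' fun v => ?_
  by_cases hv : v = r
  · subst hv; simp [A, h.1]
  · simp [A, hv]

lemma SimpleGraph.IsTree.numSpanningTrees_eq_one {V : Type*} [Finite V] {G : SimpleGraph V} (h : G.IsTree) :
    G.numSpanningTrees = 1 := by
  rw [numSpanningTrees, Set.ncard_eq_one]
  refine ⟨G, Set.ext fun T => ⟨fun hT => le_antisymm hT.1 ?_, ?_⟩⟩
  · exact (isTree_iff_minimal_connected.mp h).2 hT.2.connected hT.1
  · rintro rfl; exact ⟨le_rfl, h⟩

/-! ### Laplacian eigenvalues and spanning trees -/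

section Spectrum

variable {V : Type*} [Fintype V] [DecidableEq V]

/-- Since A maps the all-ones vector to e_r, right multiplication by 1 + 𝟙(𝟙 - e_r)ᵀ only turns row
`r` into 𝟙; this factor has determinant 1 + (n - 1). -/
lemma SimpleGraph.det_lapMatrix_updateRow_one (G : SimpleGraph V) [DecidableRel G.Adj] (r : V) :
    ((G.lapMatrix ℝ).updateRow r 1).det = Fintype.card V * G.numSpanningTrees := by
  set A := (G.lapMatrix ℝ).updateRow r (Pi.single r 1) with hA
  have hA1 : A *ᵥ 1 = Pi.single r 1 := by
    ext v
    by_cases hv : v = r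
    · subst hv
      simp [hA, Matrix.mulVec]
    · have := congrFun (G.lapMatrix_mulVec_const_eq_zero (R := ℝ)) v
      rw [Pi.single_eq_of_ne hv, hA, Matrix.mulVec, Matrix.updateRow_ne hv]
      exact this
  have hfactor : (G.lapMatrix ℝ).updateRow r 1 =
      A * (1 + replicateCol Unit (1 : V → ℝ) *
        replicateRow Unit ((1 : V → ℝ) - Pi.single r 1)) := by
    rw [Matrix.mul_add, mul_one, ← Matrix.mul_assoc]
    ext v u
    have hv1 : (A * replicateCol Unit (1 : V → ℝ)) v () = (Pi.single r 1 : V → ℝ) v := by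
      rw [← hA1]; rfl
    rw [Matrix.add_apply, Matrix.mul_apply, Fintype.sum_unique, Unique.default_eq (), hv1]
    by_cases hv : v = r
    · subst hv; simp [hA]
    · simp [hA, hv]
  rw [hfactor, det_mul, det_one_add_replicateCol_mul_replicateRow,
    G.det_lapMatrix_updateRow_single r, mul_comm]
  congr 1
  simp

/-- Columns of the Laplacian sum to zero, so adding all other rows to row `r` makes it t𝟙. -/
lemma SimpleGraph.det_lapMatrix_add_smul_one (G : SimpleGraph V) [DecidableRel G.Adj] (r : V)
    (t : ℝ) : (G.lapMatrix ℝ + t • (1 : Matrix V V ℝ)).det =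
      t * ((G.lapMatrix ℝ + t • (1 : Matrix V V ℝ)).updateRow r 1).det := by
  set M := G.lapMatrix ℝ + t • (1 : Matrix V V ℝ) with hM
  have hsum : ∑ k, (1 : ℝ) • M k = t • (1 : V → ℝ) := by
    ext u
    have h := congrFun (G.lapMatrix_mulVec_const_eq_zero (R := ℝ)) u
    have hcol : ∑ k, G.lapMatrix ℝ k u = 0 := by
      refine Eq.trans ?_ h
      simp only [Matrix.mulVec, dotProduct, mul_one]
      exact Finset.sum_congr rfl fun k _ => (G.isSymm_lapMatrix (R := ℝ)).apply u k
    rw [Finset.sum_apply]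
    simp only [one_smul, hM, Matrix.add_apply, Matrix.smul_apply, Finset.sum_add_distrib, hcol]
    simp [Matrix.one_apply]
  have h := det_updateRow_sum M r fun _ => (1 : ℝ)
  rw [hsum, det_updateRow_smul, one_smul] at h
  exact h.symm

lemma det_conj_diagonal_add_smul_one {U W : Matrix V V ℝ} (hUW : U * W = 1) (d : V → ℝ) (t : ℝ) :
    (U * diagonal d * W + t • (1 : Matrix V V ℝ)).det = ∏ v, (d v + t) := by
  have : U * diagonal d * W + t • (1 : Matrix V V ℝ) = U * diagonal (fun v => d v + t) * W := by
    have hd : diagonal (fun v => d v + t) = diagonal d + t • (1 : Matrix V V ℝ) := by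
      ext i j; by_cases h : i = j <;> simp [h]
    rw [hd, Matrix.mul_add, Matrix.add_mul]
    simp [hUW]
  rw [this, det_mul, det_mul, det_diagonal, mul_right_comm, ← det_mul, hUW, det_one, one_mul]

/-- The product of the Laplacian eigenvalues, one zero omitted, is the number of vertices times the
number of spanning trees. -/
lemma SimpleGraph.prod_erase_eq_card_mul_numSpanningTrees (G : SimpleGraph V) [DecidableRel G.Adj]
    {U W : Matrix V V ℝ} (hUW : U * W = 1) {d : V → ℝ} (hL : G.lapMatrix ℝ = U * diagonal d * W)
    {v₀ : V} (hv₀ : d v₀ = 0) :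
    ∏ v ∈ Finset.univ.erase v₀, d v = Fintype.card V * G.numSpanningTrees := by
  rw [← G.det_lapMatrix_updateRow_one v₀]
  -- For t ≠ 0 the factor t cancels from both forms of det(L + t); continuity gives t = 0.
  let p : ℝ → ℝ := fun t => ∏ v ∈ Finset.univ.erase v₀, (d v + t)
  let q : ℝ → ℝ := fun t => ((G.lapMatrix ℝ + t • (1 : Matrix V V ℝ)).updateRow v₀ 1).det
  have hp : Continuous p := by fun_prop
  have hq : Continuous q := by
    refine Continuous.matrix_det (Continuous.matrix_updateRow _ ?_ continuous_const)
    fun_prop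
  have hpq : Set.EqOn p q {0}ᶜ := by
    intro t ht
    have h := det_conj_diagonal_add_smul_one hUW d t
    rw [← hL, G.det_lapMatrix_add_smul_one v₀,
      ← Finset.mul_prod_erase _ _ (Finset.mem_univ v₀), hv₀, zero_add] at h
    exact (mul_left_cancel₀ ht h).symm
  have h0 := congrFun (hp.ext_on (dense_compl_singleton 0) hq hpq) 0
  simpa [p, q] using h0

lemma Matrix.IsHermitian.exists_eq_mul_diagonal_mul {A : Matrix V V ℝ} (hA : A.IsHermitian) :
    ∃ U W : Matrix V V ℝ, U * W = 1 ∧ A = U * diagonal hA.eigenvalues * W := by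
  refine ⟨hA.eigenvectorUnitary, star (hA.eigenvectorUnitary : Matrix V V ℝ),
    Unitary.coe_mul_star_self _, ?_⟩
  conv_lhs => rw [hA.spectral_theorem, Unitary.conjStarAlgAut_apply]
  rfl

/-- Diagonalization of the Laplacian of a tree, with the sum and the product of the nonzero
eigenvalues. -/
lemma SimpleGraph.IsTree.exists_lapMatrix_diagonalization {G : SimpleGraph V}
    [DecidableRel G.Adj] (h : G.IsTree) :
    ∃ (U W : Matrix V V ℝ) (d : V → ℝ) (v₀ : V), U * W = 1 ∧
      G.lapMatrix ℝ = U * diagonal d * W ∧ d v₀ = 0 ∧ (∀ v ∈ Finset.univ.erase v₀, 0 < d v) ∧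
      ∏ v ∈ Finset.univ.erase v₀, d v = Fintype.card V ∧
      ∑ v ∈ Finset.univ.erase v₀, d v = 2 * (Fintype.card V - 1) := by
  have : Nonempty V := h.connected.nonempty
  have hpsd := G.posSemidef_lapMatrix (R := ℝ)
  have hherm := hpsd.isHermitian
  obtain ⟨U, W, hUW, hL⟩ := hherm.exists_eq_mul_diagonal_mul
  have hdet := G.det_lapMatrix_eq_zero
  rw [hherm.det_eq_prod_eigenvalues, Finset.prod_eq_zero_iff] at hdet
  obtain ⟨v₀, -, hv₀⟩ := hdet
  replace hv₀ : hherm.eigenvalues v₀ = 0 := hv₀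
  have hprod := G.prod_erase_eq_card_mul_numSpanningTrees hUW hL hv₀
  rw [h.numSpanningTrees_eq_one, Nat.cast_one, mul_one] at hprod
  refine ⟨U, W, hherm.eigenvalues, v₀, hUW, hL, hv₀, fun v hv => ?_, hprod, ?_⟩
  · refine lt_of_le_of_ne (hpsd.eigenvalues_nonneg v) fun h0 => ?_
    rw [Finset.prod_eq_zero hv h0.symm] at hprod
    exact (Nat.cast_ne_zero (R := ℝ)).mpr Fintype.card_ne_zero hprod.symm
  · have htr := hherm.trace_eq_sum_eigenvalues
    rw [← Finset.add_sum_erase _ _ (Finset.mem_univ v₀), hv₀] at htr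
    have hdeg : (G.lapMatrix ℝ).trace = ∑ v, (G.degree v : ℝ) := by
      simp [Matrix.trace, lapMatrix, degMatrix]
    have h2 := G.sum_degrees_eq_twice_card_edges
    have h3 := h.card_edgeFinset
    have h4 : (∑ v, (G.degree v : ℝ)) = 2 * (Fintype.card V - 1) := by
      rw [← h3]; push_cast; rw [← Nat.cast_sum, h2]; push_cast; ring
    rw [hdeg, h4] at htr
    simpa using htr.symm

end Spectrum

/-! ### Cartesian products -/

open scoped Kronecker in
lemma SimpleGraph.lapMatrix_boxProd {V₁ V₂ : Type*} [Fintype V₁] [Fintype V₂] [DecidableEq V₁]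
    [DecidableEq V₂] (G₁ : SimpleGraph V₁) (G₂ : SimpleGraph V₂) [DecidableRel G₁.Adj]
    [DecidableRel G₂.Adj] [DecidableRel (G₁.boxProd G₂).Adj] :
    (G₁.boxProd G₂).lapMatrix ℝ =
      G₁.lapMatrix ℝ ⊗ₖ (1 : Matrix V₂ V₂ ℝ) + (1 : Matrix V₁ V₁ ℝ) ⊗ₖ G₂.lapMatrix ℝ := by
  ext ⟨a, b⟩ ⟨a', b'⟩
  simp only [lapMatrix, degMatrix, Matrix.sub_apply, Matrix.add_apply, diagonal_apply,
    adjMatrix_apply, kroneckerMap_apply, Matrix.one_apply, degree_boxProd, boxProd_adj,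
    Prod.mk.injEq]
  by_cases ha : a = a' <;> by_cases hb : b = b' <;> simp [ha, hb]

open scoped Kronecker in
lemma kronecker_sum_conj_diagonal {V₁ V₂ : Type*} [Fintype V₁] [Fintype V₂] [DecidableEq V₁]
    [DecidableEq V₂] {U₁ W₁ : Matrix V₁ V₁ ℝ} {U₂ W₂ : Matrix V₂ V₂ ℝ} (h₁ : U₁ * W₁ = 1)
    (h₂ : U₂ * W₂ = 1) (d₁ : V₁ → ℝ) (d₂ : V₂ → ℝ) :
    (U₁ * diagonal d₁ * W₁) ⊗ₖ (1 : Matrix V₂ V₂ ℝ) +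
        (1 : Matrix V₁ V₁ ℝ) ⊗ₖ (U₂ * diagonal d₂ * W₂) =
      (U₁ ⊗ₖ U₂) * diagonal (fun p => d₁ p.1 + d₂ p.2) * (W₁ ⊗ₖ W₂) := by
  have hd : diagonal (fun p : V₁ × V₂ => d₁ p.1 + d₂ p.2) =
      diagonal d₁ ⊗ₖ (1 : Matrix V₂ V₂ ℝ) + (1 : Matrix V₁ V₁ ℝ) ⊗ₖ diagonal d₂ := by
    rw [← diagonal_one, ← diagonal_one, diagonal_kronecker_diagonal, diagonal_kronecker_diagonal,
      diagonal_add]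
    simp
  rw [hd, Matrix.mul_add, Matrix.add_mul]
  simp only [← mul_kronecker_mul, mul_one, h₁, h₂]

/-- The number of spanning trees of a product of trees, in terms of the nonzero Laplacian
eigenvalues of the factors. -/
lemma SimpleGraph.IsTree.numSpanningTrees_boxProd_eq_prod {V₁ V₂ : Type*} [Fintype V₁]
    [Fintype V₂] [DecidableEq V₁] [DecidableEq V₂] {G₁ : SimpleGraph V₁} {G₂ : SimpleGraph V₂}
    [DecidableRel G₁.Adj] [DecidableRel G₂.Adj]
    {U₁ W₁ : Matrix V₁ V₁ ℝ} {U₂ W₂ : Matrix V₂ V₂ ℝ} {d₁ : V₁ → ℝ} {d₂ : V₂ → ℝ} {a : V₁} {b : V₂}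
    (hU₁ : U₁ * W₁ = 1) (hU₂ : U₂ * W₂ = 1) (hL₁ : G₁.lapMatrix ℝ = U₁ * diagonal d₁ * W₁)
    (hL₂ : G₂.lapMatrix ℝ = U₂ * diagonal d₂ * W₂) (ha : d₁ a = 0) (hb : d₂ b = 0)
    (hp₁ : ∏ v ∈ Finset.univ.erase a, d₁ v = Fintype.card V₁)
    (hp₂ : ∏ v ∈ Finset.univ.erase b, d₂ v = Fintype.card V₂) :
    ((G₁.boxProd G₂).numSpanningTrees : ℝ) =
      ∏ p ∈ Finset.univ.erase a ×ˢ Finset.univ.erase b, (d₁ p.1 + d₂ p.2) := by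
  classical
  have hne₁ : (Fintype.card V₁ : ℝ) ≠ 0 := by
    have : Nonempty V₁ := ⟨a⟩
    exact Nat.cast_ne_zero.mpr Fintype.card_ne_zero
  have hne₂ : (Fintype.card V₂ : ℝ) ≠ 0 := by
    have : Nonempty V₂ := ⟨b⟩
    exact Nat.cast_ne_zero.mpr Fintype.card_ne_zero
  have h := (G₁.boxProd G₂).prod_erase_eq_card_mul_numSpanningTrees
    (d := fun p => d₁ p.1 + d₂ p.2) (v₀ := (a, b))
    (by rw [← mul_kronecker_mul, hU₁, hU₂, one_kronecker_one])
    (by rw [lapMatrix_boxProd, hL₁, hL₂, kronecker_sum_conj_diagonal hU₁ hU₂]) (by simp [ha, hb])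
  -- Pairs with exactly one index at a zero eigenvalue contribute the factor n₁n₂, which cancels the
  -- order of the product graph.
  have hsplit : (Finset.univ.erase (a, b) : Finset (V₁ × V₂)) =
      ((Finset.univ.erase a ×ˢ Finset.univ.erase b) ∪ (Finset.univ.erase a ×ˢ {b})) ∪
        ({a} ×ˢ Finset.univ.erase b) := by
    ext ⟨x, y⟩
    simp only [Finset.mem_erase, Finset.mem_univ, Finset.mem_union, Finset.mem_product,
      Finset.mem_singleton, Prod.mk.injEq, ne_eq, and_true]
    tauto
  rw [hsplit, Finset.prod_union, Finset.prod_union, Finset.prod_product _ {b},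
    Finset.prod_product {a}] at h
  · simp only [Finset.prod_singleton, ha, hb, add_zero, zero_add, hp₁, hp₂, Fintype.card_prod,
      Nat.cast_mul] at h
    refine mul_left_cancel₀ (mul_ne_zero hne₁ hne₂) ?_
    rw [← h]; ring
  · rw [Finset.disjoint_left]
    rintro ⟨x, y⟩; simp; tauto
  · rw [Finset.disjoint_left]
    rintro ⟨x, y⟩; simp; tauto

/-! ### Strict inequalities -/

/-- If all values were equal, the sum would force 2, and then 2^m = m + 1, false for m ≥ 2. -/
lemma exists_ne_of_prod_eq_succ_card {ι : Type*} {s : Finset ι} {d : ι → ℝ} (hs : 2 ≤ s.card)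
    (hprod : ∏ i ∈ s, d i = s.card + 1) (hsum : ∑ i ∈ s, d i = 2 * s.card) :
    ∃ i ∈ s, ∃ j ∈ s, d i ≠ d j := by
  by_contra! hc
  obtain ⟨i, hi⟩ : s.Nonempty := Finset.card_pos.mp (by omega)
  have hconst : ∀ j ∈ s, d j = d i := fun j hj => hc j hj i hi
  rw [Finset.sum_congr rfl hconst, Finset.sum_const, nsmul_eq_mul] at hsum
  rw [Finset.prod_congr rfl hconst, Finset.prod_const] at hprod
  have hpos : (s.card : ℝ) ≠ 0 := by positivity
  have h2 : d i = 2 := mul_left_cancel₀ hpos (by rw [hsum]; ring)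
  rw [h2] at hprod
  have hnat : 2 ^ s.card = s.card + 1 := by exact_mod_cast hprod
  have hlt : ∀ n, 2 ≤ n → n + 1 < 2 ^ n := by
    intro n hn
    induction n, hn using Nat.le_induction with
    | base => norm_num
    | succ n _ ih => rw [pow_succ]; omega
  exact (hlt _ hs).ne' hnat

lemma exists_mem_product_ne_of_ne {ι κ : Type*} {s : Finset ι} {t : Finset κ} {f : ι → ℝ}
    {g : κ → ℝ} (hf : ∃ i ∈ s, ∃ j ∈ s, f i ≠ f j) (ht : t.Nonempty) :
    ∃ p ∈ s ×ˢ t, f p.1 ≠ g p.2 := by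
  obtain ⟨i, hi, j, hj, hij⟩ := hf
  obtain ⟨k, hk⟩ := ht
  by_cases h : f i = g k
  · exact ⟨(j, k), Finset.mk_mem_product hj hk, fun h' => hij (h.trans h'.symm)⟩
  · exact ⟨(i, k), Finset.mk_mem_product hi hk, h⟩

/-- Strict AM-GM: multiply x/c ≤ exp(x/c - 1); the exponents sum to zero. -/
lemma prod_lt_pow_of_sum_eq {ι : Type*} {s : Finset ι} {x : ι → ℝ} {c : ℝ} (hc : 0 < c)
    (hx : ∀ i ∈ s, 0 < x i) (hsum : ∑ i ∈ s, x i = c * s.card) (hne : ∃ i ∈ s, x i ≠ c) :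
    ∏ i ∈ s, x i < c ^ s.card := by
  have h : ∏ i ∈ s, x i / c < ∏ i ∈ s, Real.exp (x i / c - 1) := by
    refine Finset.prod_lt_prod (fun i hi => div_pos (hx i hi) hc) (fun i _ => ?_) ?_
    · linarith [Real.add_one_le_exp (x i / c - 1)]
    · obtain ⟨i, hi, hic⟩ := hne
      refine ⟨i, hi, ?_⟩
      have : x i / c - 1 ≠ 0 := by rwa [sub_ne_zero, ne_eq, div_eq_one_iff_eq hc.ne']
      linarith [Real.add_one_lt_exp this]
  rw [← Real.exp_sum, Finset.sum_sub_distrib, ← Finset.sum_div, hsum, Finset.prod_div_distrib,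
    Finset.prod_const, mul_div_cancel_left₀ _ hc.ne'] at h
  simpa [div_lt_one (pow_pos hc _)] using h

lemma prod_four_mul_lt_sq_prod_add {ι κ : Type*} {s : Finset ι} {t : Finset κ} {f : ι → ℝ}
    {g : κ → ℝ} (hf : ∀ i ∈ s, 0 < f i) (hg : ∀ i ∈ t, 0 < g i)
    (hne : ∃ p ∈ s ×ˢ t, f p.1 ≠ g p.2) :
    4 ^ (s.card * t.card) * (∏ i ∈ s, f i) ^ t.card * (∏ i ∈ t, g i) ^ s.card <
      (∏ p ∈ s ×ˢ t, (f p.1 + g p.2)) ^ 2 := by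
  have hl : 4 ^ (s.card * t.card) * (∏ i ∈ s, f i) ^ t.card * (∏ i ∈ t, g i) ^ s.card =
      ∏ p ∈ s ×ˢ t, (4 * f p.1 * g p.2) := by
    rw [Finset.prod_mul_distrib, Finset.prod_mul_distrib, Finset.prod_const, Finset.card_product,
      Finset.prod_product, Finset.prod_product]
    simp [Finset.prod_pow]
  rw [hl, ← Finset.prod_pow]
  refine Finset.prod_lt_prod (fun p hp => ?_) (fun p _ => ?_) ?_
  · obtain ⟨h1, h2⟩ := Finset.mem_product.mp hp
    have := hf _ h1
    have := hg _ h2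
    positivity
  · nlinarith [sq_nonneg (f p.1 - g p.2)]
  · obtain ⟨p, hp, h⟩ := hne
    have := sq_pos_of_ne_zero (sub_ne_zero.mpr h)
    exact ⟨p, hp, by nlinarith⟩

lemma rpow_sub_one_div_two_sq {x y : ℝ} {n : ℕ} (hx : 0 ≤ x) (hn : y - 1 = n) :
    (x ^ ((y - 1) / 2)) ^ 2 = x ^ n := by
  rw [← Real.rpow_natCast (_ ^ _), ← Real.rpow_mul hx, hn, ← Real.rpow_natCast x n]
  congr 1
  push_cast
  ring

theorem mainTheorem4 {V₁ V₂ : Type*} [Fintype V₁] [Fintype V₂]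
    (G₁ : SimpleGraph V₁) (G₂ : SimpleGraph V₂) (hG₁ : G₁.IsTree) (hG₂ : G₂.IsTree)
    (n₁ n₂ : ℕ) (hn₁ : Fintype.card V₁ = n₁) (hn₂ : Fintype.card V₂ = n₂)
    (h₁ : 3 ≤ n₁) (h₂ : 3 ≤ n₂) :
    (2 : ℝ) ^ ((n₁ - 1) * (n₂ - 1)) * (n₁ : ℝ) ^ (((n₂ : ℝ) - 1) / 2) *
        (n₂ : ℝ) ^ (((n₁ : ℝ) - 1) / 2) < ((G₁.boxProd G₂).numSpanningTrees : ℝ) ∧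
      (G₁.boxProd G₂).numSpanningTrees < 2 ^ (2 * (n₁ - 1) * (n₂ - 1)) := by
  classical
  obtain ⟨U₁, W₁, d₁, a, hU₁, hL₁, ha, hpos₁, hp₁, hs₁⟩ := hG₁.exists_lapMatrix_diagonalization
  obtain ⟨U₂, W₂, d₂, b, hU₂, hL₂, hb, hpos₂, hp₂, hs₂⟩ := hG₂.exists_lapMatrix_diagonalization
  have hτ := SimpleGraph.IsTree.numSpanningTrees_boxProd_eq_prod hU₁ hU₂ hL₁ hL₂ ha hb hp₁ hp₂
  rw [hn₁] at hp₁ hs₁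
  rw [hn₂] at hp₂ hs₂
  set s := Finset.univ.erase a
  set t := Finset.univ.erase b
  have hsc : s.card = n₁ - 1 := by simp [s, Finset.card_erase_of_mem, hn₁]
  have htc : t.card = n₂ - 1 := by simp [t, Finset.card_erase_of_mem, hn₂]
  have hsc' : (n₁ : ℝ) - 1 = s.card := by rw [hsc]; push_cast [show 1 ≤ n₁ by omega]; rfl
  have htc' : (n₂ : ℝ) - 1 = t.card := by rw [htc]; push_cast [show 1 ≤ n₂ by omega]; rfl
  have hne : ∃ i ∈ s, ∃ j ∈ s, d₁ i ≠ d₁ j :=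
    exists_ne_of_prod_eq_succ_card (by omega) (by rw [hp₁, ← hsc']; ring) (by rw [hs₁, hsc'])
  have ht : t.Nonempty := Finset.card_pos.mp (by omega)
  constructor
  -- Squaring clears the half-integer exponents.
  · refine lt_of_pow_lt_pow_left₀ 2 (Nat.cast_nonneg _) ?_
    have h := prod_four_mul_lt_sq_prod_add hpos₁ hpos₂
      (exists_mem_product_ne_of_ne (g := d₂) hne ht)
    rw [← hτ, hp₁, hp₂] at h
    rw [mul_pow, mul_pow, rpow_sub_one_div_two_sq (Nat.cast_nonneg _) htc',
      rpow_sub_one_div_two_sq (Nat.cast_nonneg _) hsc', ← hsc, ← htc, ← pow_mul, mul_comm _ 2,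
      pow_mul]
    norm_num
    exact h
  · have hsum : ∑ p ∈ s ×ˢ t, (d₁ p.1 + d₂ p.2) = 4 * (s ×ˢ t).card := by
      rw [Finset.sum_product, Finset.card_product]
      simp only [Finset.sum_add_distrib, Finset.sum_const, nsmul_eq_mul, ← Finset.mul_sum, hs₁,
        hs₂, hsc', htc']
      push_cast
      ring
    have hlt := prod_lt_pow_of_sum_eq (by norm_num) (fun p hp => add_pos
      (hpos₁ _ (Finset.mem_product.mp hp).1) (hpos₂ _ (Finset.mem_product.mp hp).2)) hsum (by
        -- Comparing with 4 - μ_j yields a pair with λ_i + μ_j ≠ 4.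
        obtain ⟨p, hp, h⟩ := exists_mem_product_ne_of_ne (g := fun j => 4 - d₂ j) hne ht
        exact ⟨p, hp, fun h' => h (eq_sub_of_add_eq h')⟩)
    rw [← hτ, Finset.card_product, hsc, htc] at hlt
    rw [mul_assoc, pow_mul]
    exact_mod_cast hlt
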